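/- Let $\mathbb{F}_q$ be a finite field, $n\ge 0$, and write $C^\perp$ for the Euclidean dual of a linear code $C\subseteq\mathbb{F}_q^n$. Linear codes $C,C'\subseteq\mathbb{F}_q^n$ are monomially equivalent if $C'=CM=\{vM : v\in C\}$ for an invertible matrix $M$ all of whose rows have exactly one nonzero entry. Fix a nontrivial additive character $\psi$ of $\mathbb{F}_q$. For $a,b\in\mathbb{F}_q^m$ let $X(a)Z(b)$ be the Pauli operator $|y\rangle\mapsto\psi(b\cdot y)\,|y+a\rangle$ on $(\mathbb{C}^q)^{\otimes m}$. **CSS construction.** Let $C_1,C_2\subseteq\mathbb{F}_q^n$ be linear codes and $c=\dim C_1-\dim(C_1\cap C_2^\perp)$. An (entanglement-assisted) quantum code obtained via the CSS construction using $C_1$ and $C_2$ is a subspace $Q\subseteq(\mathbb{C}^q)^{\otimes n}\otimes(\mathbb{C}^q)^{\otimes c}$ of the following form: $Q$ is the joint $+1$ eigenspace of all $X(a)$, $a\in D_1$, and all $Z(b)$, $b\in D_2$, where $D_1,D_2\subseteq\mathbb{F}_q^{n+c}$ are linear codes with $D_1\perp D_2$ such that deleting the last $c$ coordinates maps $D_i$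 isomorphically onto $C_i$ ($i=1,2$). **Minimum distance and purity.** Errors are the Pauli operators $E=X(a)Z(b)\otimes I$ with $a,b\in\mathbb{F}_q^n$, of weight $\#\{i : (a_i,b_i)\ne(0,0)\}$. Let $P$ be the orthogonal projection onto $Q$. The code $Q$ detects $E$ if $PEP=zP$ for some scalar $z$. The minimum distance $\delta(Q)\in\mathbb{N}\cup\{\infty\}$ is the least weight of an error that $Q$ does not detect; if $\dim Q=1$ it is, as usual, the least weight of an error with $(a,b)\neq(0,0)$ and $PEP\neq 0$. (The minimum of the empty set is $\infty$.) The code $Q$ is pure if $PEP=0$ for every error $E$ with $(a,b)\ne(0,0)$ of weight less than $\delta(Q)$. **Corollary.** Let $Q$ be a pure quantum code obtained via the CSS construction using $C_1$ and $C_2$, and let $Q'$ be a quantum code obtained via the CSS construction using $C_1$ and a code $C_2'$ that is monomially equivalent to $C_2$. Then $\delta(Q')\ge\delta(Q)$. -/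

import Mathlib

open scoped Matrix

/-! ### Linear codes -/

/-- The Euclidean dual of a linear code. -/
def dualCode {F : Type*} [Field F] {n : ℕ} (C : Submodule F (Fin n → F)) :
    Submodule F (Fin n → F) where
  carrier := {x | ∀ v ∈ C, x ⬝ᵥ v = 0}
  zero_mem' := fun v _ => by simp
  add_mem' := fun hx hy v hv => by rw [add_dotProduct, hx v hv, hy v hv, add_zero]
  smul_mem' := fun r x hx v hv => by rw [smul_dotProduct, hx v hv, smul_zero]

/-- A monomial matrix: an invertible matrix all of whose rows have Hamming weight one. -/
def IsMonomialMatrix {F : Type*} [Field F] [DecidableEq F] {n : ℕ}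
    (M : Matrix (Fin n) (Fin n) F) : Prop :=
  IsUnit M ∧ ∀ i, hammingNorm (M i) = 1

/-- `C'` is monomially equivalent to `C`: `C' = C M = {v M | v ∈ C}`, `M` monomial. -/
def MonomiallyEquivalent {F : Type*} [Field F] [DecidableEq F] {n : ℕ}
    (C C' : Submodule F (Fin n → F)) : Prop :=
  ∃ M : Matrix (Fin n) (Fin n) F, IsMonomialMatrix M ∧ C' = C.map M.vecMulLinear

/-! ### Qudits, Pauli operators and entanglement-assisted quantum codes -/

/-- The state space of a register of qudits of dimension `|F|` indexed by `ι`, that is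
`⨂_{i : ι} ℂ^F`: its orthonormal computational basis is indexed by `ι → F`. -/
abbrev QuditSpace (F ι : Type*) [Fintype F] [Fintype ι] [DecidableEq ι] : Type _ :=
  EuclideanSpace ℂ (ι → F)

/-- The generalized Pauli operator `X(a) Z(b)`, given on basis states by
`X(a) Z(b) |y⟩ = ψ(b · y) |y + a⟩`, where `ψ` is an additive character of `F`. -/
def pauliOp {F ι : Type*} [Field F] [Fintype F] [Fintype ι] [DecidableEq ι]
    (ψ : AddChar F ℂ) (a b : ι → F) : QuditSpace F ι →ₗ[ℂ] QuditSpace F ι where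
  toFun f := WithLp.toLp 2 fun x => ψ (b ⬝ᵥ (x - a)) * f (x - a)
  map_add' f g := by
    ext x
    simp [mul_add]
  map_smul' r f := by
    ext x
    simp [mul_left_comm]

/-- The Pauli error `X(a) Z(b)` on the `n` transmitted qudits, acting as the identity on the
`c` qudits of the receiver's (error-free) halves of the entangled pairs. -/
def pauliError {F : Type*} [Field F] [Fintype F] (ψ : AddChar F ℂ) {n : ℕ} (c : ℕ)
    (a b : Fin n → F) : QuditSpace F (Fin n ⊕ Fin c) →ₗ[ℂ] QuditSpace F (Fin n ⊕ Fin c) :=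
  pauliOp ψ (Sum.elim a 0) (Sum.elim b 0)

/-- The weight of the Pauli error `X(a) Z(b)`: the number of qudits on which it is not scalar. -/
def pauliWeight {F : Type*} [Field F] [DecidableEq F] {n : ℕ} (a b : Fin n → F) : ℕ :=
  hammingNorm fun i => (a i, b i)

/-- The subspace `Q` detects the error `E`: `P E P = z P` for a scalar `z`, where `P` is the
orthogonal projection onto `Q`. -/
def Detects {H : Type*} [NormedAddCommGroup H] [InnerProductSpace ℂ H]
    (Q : Submodule ℂ H) (E : H →ₗ[ℂ] H) : Prop :=
  ∃ z : ℂ, ∀ u ∈ Q, ∀ v ∈ Q, inner ℂ u (E v) = z * inner ℂ u v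

/-- The error `E` maps the subspace `Q` to a subspace orthogonal to `Q`: `P E P = 0`. -/
def MapsToOrthogonal {H : Type*} [NormedAddCommGroup H] [InnerProductSpace ℂ H]
    (Q : Submodule ℂ H) (E : H →ₗ[ℂ] H) : Prop :=
  ∀ u ∈ Q, ∀ v ∈ Q, inner ℂ u (E v) = 0

open Classical in
/-- The minimum distance of an entanglement-assisted quantum code `Q`: the least weight of a
Pauli error on the transmitted qudits that `Q` does not detect. A one-dimensional code detects
everything; for it the usual convention is the least weight of a non-identity Pauli error that
does not map `Q` to a subspace orthogonal to `Q`. The value is `⊤` when there is no such error. -/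
noncomputable def minDist {F : Type*} [Field F] [Fintype F] [DecidableEq F]
    (ψ : AddChar F ℂ) {n c : ℕ} (Q : Submodule ℂ (QuditSpace F (Fin n ⊕ Fin c))) : ℕ∞ :=
  if Module.finrank ℂ Q = 1 then
    sInf {w : ℕ∞ | ∃ a b : Fin n → F, (a ≠ 0 ∨ b ≠ 0) ∧
      ¬ MapsToOrthogonal Q (pauliError ψ c a b) ∧ w = pauliWeight a b}
  else
    sInf {w : ℕ∞ | ∃ a b : Fin n → F,
      ¬ Detects Q (pauliError ψ c a b) ∧ w = pauliWeight a b}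

/-- `Q` is pure: every non-identity Pauli error on the transmitted qudits of weight less than the
minimum distance maps `Q` to a subspace orthogonal to `Q`. -/
def IsPureCode {F : Type*} [Field F] [Fintype F] [DecidableEq F]
    (ψ : AddChar F ℂ) {n c : ℕ} (Q : Submodule ℂ (QuditSpace F (Fin n ⊕ Fin c))) : Prop :=
  ∀ a b : Fin n → F, (a ≠ 0 ∨ b ≠ 0) → (pauliWeight a b : ℕ∞) < minDist ψ Q →
    MapsToOrthogonal Q (pauliError ψ c a b)

/-! ### The CSS construction -/

/-- The joint `+1` eigenspace of the operators `X(a)`, `a ∈ D₁`, and `Z(b)`, `b ∈ D₂`. -/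
def stabilizedSpace {F ι : Type*} [Field F] [Fintype F] [Fintype ι] [DecidableEq ι]
    (ψ : AddChar F ℂ) (D₁ D₂ : Submodule F (ι → F)) : Submodule ℂ (QuditSpace F ι) where
  carrier := {f | (∀ a ∈ D₁, pauliOp ψ a 0 f = f) ∧ (∀ b ∈ D₂, pauliOp ψ 0 b f = f)}
  zero_mem' := by simp
  add_mem' := fun hf hg => ⟨fun a ha => by rw [map_add, hf.1 a ha, hg.1 a ha],
    fun b hb => by rw [map_add, hf.2 b hb, hg.2 b hb]⟩
  smul_mem' := fun r f hf => ⟨fun a ha => by rw [map_smul, hf.1 a ha],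
    fun b hb => by rw [map_smul, hf.2 b hb]⟩

/-- `D ⊆ F^(n+c)` extends `C ⊆ F^n`: forgetting the last `c` coordinates maps `D` isomorphically
onto `C`. -/
def IsCodeExtension {F : Type*} [Field F] {n c : ℕ}
    (C : Submodule F (Fin n → F)) (D : Submodule F (Fin n ⊕ Fin c → F)) : Prop :=
  D.map (LinearMap.funLeft F F Sum.inl) = C ∧ Module.finrank F D = Module.finrank F C

/-- `Q` is an entanglement-assisted quantum code obtained by the CSS construction from `C₁` and
`C₂`, with `c = dim C₁ - dim (C₁ ∩ C₂^⊥)` pairs of maximally entangled qudits: the checks `X(a)`,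
`a ∈ C₁`, and `Z(b)`, `b ∈ C₂`, are extended by operators on the receiver's `c` qudits so that
they commute, and `Q` is the space they stabilize. -/
def IsCSSCode {F : Type*} [Field F] [Fintype F] (ψ : AddChar F ℂ) {n c : ℕ}
    (C₁ C₂ : Submodule F (Fin n → F))
    (Q : Submodule ℂ (QuditSpace F (Fin n ⊕ Fin c))) : Prop :=
  c + Module.finrank F ↥(C₁ ⊓ dualCode C₂) = Module.finrank F C₁ ∧
  ∃ D₁ D₂ : Submodule F (Fin n ⊕ Fin c → F),
    IsCodeExtension C₁ D₁ ∧ IsCodeExtension C₂ D₂ ∧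
    (∀ a ∈ D₁, ∀ b ∈ D₂, a ⬝ᵥ b = 0) ∧ Q = stabilizedSpace ψ D₁ D₂

/-!
For a pure code, the minimum distance `δ(Q)` is a lower bound for the weights of the nonzero words
of `C₁^⊥` and `C₂^⊥`. Any CSS code from `C₁` and `C₂` has minimum distance at least the least such
weight, and replacing `C₂` by a monomially equivalent code does not change that weight.

Let `Q` be the space stabilized by `X(D₁)` and `Z(D₂)`. Pauli operators are unitary and commute up
to values of `ψ` (`pauliOp_comm`). Hence an error `X(a) Z(b)` that fails to commute with some
stabilizer maps `Q` to a subspace orthogonal to `Q`; as `ψ` is nontrivial, any error that does not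
do so has `a ∈ C₂^⊥` and `b ∈ C₁^⊥` (`mem_dualCode_of_not_mapsToOrthogonal`). Conversely, an error
with `a ∈ C₂^⊥` and `b ∈ C₁^⊥` commutes with all stabilizers, so it maps `Q` isometrically into
itself, and `Q ≠ 0` since the indicator function of `D₁` lies in `Q`; such an error does not map
`Q` to an orthogonal subspace (`not_mapsToOrthogonal_of_mem_dualCode`). If `Q` is pure, every
nonzero word of `C₂^⊥` and of `C₁^⊥` therefore has weight at least `δ(Q)`.

For `Q'`, an error counted in `δ(Q')` is never the identity and does not map `Q'` to an orthogonal
subspace, so `a ∈ C₂'^⊥` and `b ∈ C₁^⊥`, not both zero. If `b ≠ 0` its weight is at least `δ(Q)`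
at once. If `a ≠ 0` and `C₂' = C₂ M`, then `M a` is a nonzero word of `C₂^⊥` whose weight is at
most that of `a`, because the positions of the nonzero entries of the rows of `M` form a
permutation.
-/

/-! ### Monomial matrices and Hamming weight -/

lemma IsMonomialMatrix.exists_injective {F : Type*} [Field F] [DecidableEq F] {n : ℕ}
    {M : Matrix (Fin n) (Fin n) F} (hM : IsMonomialMatrix M) :
    ∃ σ : Fin n → Fin n, Function.Injective σ ∧ ∀ i j, j ≠ σ i → M i j = 0 := by
  have h : ∀ i, ∃ s, ∀ j, j ≠ s → M i j = 0 := by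
    intro i
    obtain ⟨s, hs⟩ := Finset.card_eq_one.mp (hM.2 i)
    refine ⟨s, fun j hj => ?_⟩
    by_contra hne
    have : j ∈ ({s} : Finset (Fin n)) := hs ▸ by simpa using hne
    exact hj (by simpa using this)
  choose σ hσ using h
  refine ⟨σ, Finite.injective_iff_surjective.mpr fun j => ?_, hσ⟩
  by_contra! hj
  -- A column outside the range of `σ` vanishes, which contradicts invertibility.
  have hz : M *ᵥ Pi.single j 1 = M *ᵥ 0 := by
    ext i
    simpa using hσ i j (hj i).symm
  have := congrFun (Matrix.mulVec_injective_iff_isUnit.mpr hM.1 hz) j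
  simp at this

lemma IsMonomialMatrix.hammingNorm_mulVec_le {F : Type*} [Field F] [DecidableEq F] {n : ℕ}
    {M : Matrix (Fin n) (Fin n) F} (hM : IsMonomialMatrix M) (a : Fin n → F) :
    hammingNorm (M *ᵥ a) ≤ hammingNorm a := by
  obtain ⟨σ, hinj, hσ⟩ := hM.exists_injective
  refine Finset.card_le_card_of_injOn σ (fun i hi => ?_) hinj.injOn
  simp only [Finset.coe_filter, Finset.mem_univ, true_and, Set.mem_ofPred_eq] at hi ⊢
  refine fun ha => hi ?_
  rw [Matrix.mulVec, dotProduct]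
  refine Finset.sum_eq_zero fun j _ => ?_
  by_cases hj : j = σ i
  · rw [hj, ha, mul_zero]
  · rw [hσ i j hj, zero_mul]

lemma mulVec_mem_dualCode {F : Type*} [Field F] {n : ℕ} {C : Submodule F (Fin n → F)}
    {M : Matrix (Fin n) (Fin n) F} {a : Fin n → F}
    (ha : a ∈ dualCode (C.map M.vecMulLinear)) : M *ᵥ a ∈ dualCode C := by
  intro v hv
  have := ha _ (Submodule.mem_map_of_mem hv)
  rwa [Matrix.vecMulLinear_apply, dotProduct_comm, ← Matrix.dotProduct_mulVec,
    dotProduct_comm] at this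

/-! ### Weight of Pauli errors -/

lemma hammingNorm_le_pauliWeight_left {F : Type*} [Field F] [DecidableEq F] {n : ℕ}
    (a b : Fin n → F) : hammingNorm a ≤ pauliWeight a b :=
  hammingNorm_comp_le_hammingNorm (x := fun i => (a i, b i)) (fun _ => Prod.fst) fun _ => rfl

lemma hammingNorm_le_pauliWeight_right {F : Type*} [Field F] [DecidableEq F] {n : ℕ}
    (a b : Fin n → F) : hammingNorm b ≤ pauliWeight a b :=
  hammingNorm_comp_le_hammingNorm (x := fun i => (a i, b i)) (fun _ => Prod.snd) fun _ => rfl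

lemma pauliWeight_zero_right {F : Type*} [Field F] [DecidableEq F] {n : ℕ}
    (a : Fin n → F) : pauliWeight a 0 = hammingNorm a := by
  simp [pauliWeight, hammingNorm]

lemma pauliWeight_zero_left {F : Type*} [Field F] [DecidableEq F] {n : ℕ}
    (b : Fin n → F) : pauliWeight 0 b = hammingNorm b := by
  simp [pauliWeight, hammingNorm]

/-! ### Pauli operators -/

lemma AddChar.exists_apply_mul_ne_one {F : Type*} [Field F] {ψ : AddChar F ℂ} (hψ : ψ ≠ 1) {s : F}
    (hs : s ≠ 0) : ∃ t, ψ (t * s) ≠ 1 := by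
  obtain ⟨x, hx⟩ := AddChar.ne_one_iff.mp hψ
  exact ⟨x / s, by rwa [div_mul_cancel₀ _ hs]⟩

section Pauli

variable {F ι : Type*} [Field F] [Fintype F] [Fintype ι] [DecidableEq ι]

lemma pauliOp_apply (ψ : AddChar F ℂ) (a b : ι → F) (f : QuditSpace F ι) (x : ι → F) :
    pauliOp ψ a b f x = ψ (b ⬝ᵥ (x - a)) * f (x - a) := rfl

lemma pauliOp_zero (ψ : AddChar F ℂ) (f : QuditSpace F ι) : pauliOp ψ 0 0 f = f := by
  ext x
  simp [pauliOp_apply]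

lemma inner_pauliOp_pauliOp (ψ : AddChar F ℂ) (a b : ι → F) (u v : QuditSpace F ι) :
    inner ℂ (pauliOp ψ a b u) (pauliOp ψ a b v) = inner ℂ u v := by
  simp only [PiLp.inner_apply, pauliOp_apply]
  rw [← (Equiv.subRight a).sum_comp (fun x => inner ℂ (u x) (v x))]
  refine Finset.sum_congr rfl fun x _ => ?_
  have h : ψ (b ⬝ᵥ (x - a)) * (starRingEnd ℂ) (ψ (b ⬝ᵥ (x - a))) = 1 := by
    rw [Complex.mul_conj', AddChar.norm_apply]
    simp
  simp only [Equiv.subRight_apply, RCLike.inner_apply, map_mul]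
  linear_combination (v (x - a) * (starRingEnd ℂ) (u (x - a))) * h

/-- Two Pauli operators commute up to the character value of their symplectic product. -/
lemma pauliOp_comm (ψ : AddChar F ℂ) (a b c d : ι → F) (f : QuditSpace F ι) :
    pauliOp ψ a b (pauliOp ψ c d f) =
      ψ (b ⬝ᵥ c - d ⬝ᵥ a) • pauliOp ψ c d (pauliOp ψ a b f) := by
  ext x
  simp only [pauliOp_apply, PiLp.smul_apply, smul_eq_mul]
  rw [sub_right_comm x c a, ← mul_assoc, ← mul_assoc, ← mul_assoc, ← AddChar.map_add_eq_mul,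
    ← AddChar.map_add_eq_mul, ← AddChar.map_add_eq_mul]
  congr 2
  simp only [dotProduct_sub]
  ring

/-- If an error and a stabilizer commute only up to a scalar `≠ 1`, matrix elements of the error
between stabilized vectors vanish. -/
lemma inner_pauliOp_eq_zero (ψ : AddChar F ℂ) {a b c d : ι → F} {u v : QuditSpace F ι}
    (hu : pauliOp ψ a b u = u) (hv : pauliOp ψ a b v = v)
    (hne : ψ (b ⬝ᵥ c - d ⬝ᵥ a) ≠ 1) : inner ℂ u (pauliOp ψ c d v) = 0 := by
  have h := inner_pauliOp_pauliOp ψ a b u (pauliOp ψ c d v)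
  rw [hu, pauliOp_comm, hv, inner_smul_right] at h
  by_contra h0
  exact hne (mul_right_cancel₀ h0 (h.trans (one_mul _).symm))

lemma pauliOp_mem_stabilizedSpace (ψ : AddChar F ℂ) {D₁ D₂ : Submodule F (ι → F)} {c d : ι → F}
    (hc : ∀ b ∈ D₂, b ⬝ᵥ c = 0) (hd : ∀ a ∈ D₁, d ⬝ᵥ a = 0) {f : QuditSpace F ι}
    (hf : f ∈ stabilizedSpace ψ D₁ D₂) : pauliOp ψ c d f ∈ stabilizedSpace ψ D₁ D₂ := by
  refine ⟨fun a ha => ?_, fun b hb => ?_⟩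
  · rw [pauliOp_comm, hf.1 a ha, hd a ha]
    simp
  · rw [pauliOp_comm, hf.2 b hb, hc b hb]
    simp

/-- The unnormalized uniform superposition of the words of `D₁` is stabilized, so the stabilized
space is nonzero. -/
lemma exists_ne_zero_mem_stabilizedSpace (ψ : AddChar F ℂ) {D₁ D₂ : Submodule F (ι → F)}
    (h : ∀ a ∈ D₁, ∀ b ∈ D₂, a ⬝ᵥ b = 0) : ∃ f ∈ stabilizedSpace ψ D₁ D₂, f ≠ 0 := by
  classical
  refine ⟨WithLp.toLp 2 fun x => if x ∈ D₁ then 1 else 0, ⟨fun a ha => ?_, fun b hb => ?_⟩,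
    fun h0 => ?_⟩
  · ext x
    simp [pauliOp_apply, D₁.sub_mem_iff_left ha]
  · ext x
    by_cases hx : x ∈ D₁
    · simp [pauliOp_apply, hx, dotProduct_comm b x, h x hx b hb]
    · simp [pauliOp_apply, hx]
  · have := congrArg (fun f : QuditSpace F ι => f 0) h0
    simp at this

end Pauli

/-! ### Errors on CSS codes -/

lemma sumElim_zero_dotProduct {F : Type*} [Field F] {n c : ℕ} (a : Fin n → F)
    (d : Fin n ⊕ Fin c → F) :
    Sum.elim a 0 ⬝ᵥ d = a ⬝ᵥ LinearMap.funLeft F F Sum.inl d := by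
  simp [dotProduct, Fintype.sum_sum_type, LinearMap.funLeft_apply]

lemma IsCodeExtension.mem_dualCode_iff {F : Type*} [Field F] {n c : ℕ}
    {C : Submodule F (Fin n → F)} {D : Submodule F (Fin n ⊕ Fin c → F)}
    (h : IsCodeExtension C D) (a : Fin n → F) :
    a ∈ dualCode C ↔ ∀ d ∈ D, Sum.elim a 0 ⬝ᵥ d = 0 := by
  rw [← h.1]
  simp only [sumElim_zero_dotProduct]
  refine ⟨fun ha d hd => ha _ (Submodule.mem_map_of_mem hd), ?_⟩
  rintro ha _ ⟨d, hd, rfl⟩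
  exact ha d hd

section CSS

variable {F : Type*} [Field F] [Fintype F] {n c : ℕ}

/-- An error that fails to commute with some stabilizer maps a CSS code to an orthogonal subspace;
the remaining errors have both components in the dual codes. -/
lemma mem_dualCode_of_not_mapsToOrthogonal {ψ : AddChar F ℂ} (hψ : ψ ≠ 1)
    {C₁ C₂ : Submodule F (Fin n → F)} {Q : Submodule ℂ (QuditSpace F (Fin n ⊕ Fin c))}
    (hQ : IsCSSCode ψ C₁ C₂ Q) {a b : Fin n → F}
    (h : ¬ MapsToOrthogonal Q (pauliError ψ c a b)) : a ∈ dualCode C₂ ∧ b ∈ dualCode C₁ := by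
  obtain ⟨-, D₁, D₂, h₁, h₂, -, rfl⟩ := hQ
  constructor
  · rw [h₂.mem_dualCode_iff]
    by_contra! ⟨d, hd, hne⟩
    -- `ψ` may equal `1` at this nonzero value; scaling `d` within `D₂` avoids that.
    obtain ⟨t, ht⟩ := AddChar.exists_apply_mul_ne_one hψ hne
    refine h fun u hu v hv => ?_
    have htd := D₂.smul_mem t hd
    refine inner_pauliOp_eq_zero ψ (hu.2 _ htd) (hv.2 _ htd) ?_
    rwa [dotProduct_zero, sub_zero, smul_dotProduct, dotProduct_comm, smul_eq_mul]
  · rw [h₁.mem_dualCode_iff]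
    by_contra! ⟨d, hd, hne⟩
    obtain ⟨t, ht⟩ := AddChar.exists_apply_mul_ne_one hψ (neg_ne_zero.mpr hne)
    refine h fun u hu v hv => ?_
    have htd := D₁.smul_mem t hd
    refine inner_pauliOp_eq_zero ψ (hu.1 _ htd) (hv.1 _ htd) ?_
    rwa [zero_dotProduct, zero_sub, dotProduct_smul, smul_eq_mul, ← mul_neg]

lemma not_mapsToOrthogonal_of_mem_dualCode {ψ : AddChar F ℂ} {C₁ C₂ : Submodule F (Fin n → F)}
    {Q : Submodule ℂ (QuditSpace F (Fin n ⊕ Fin c))} (hQ : IsCSSCode ψ C₁ C₂ Q)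
    {a b : Fin n → F} (ha : a ∈ dualCode C₂) (hb : b ∈ dualCode C₁) :
    ¬ MapsToOrthogonal Q (pauliError ψ c a b) := by
  obtain ⟨-, D₁, D₂, h₁, h₂, hD, rfl⟩ := hQ
  obtain ⟨f, hf, hf0⟩ := exists_ne_zero_mem_stabilizedSpace ψ hD
  rw [h₂.mem_dualCode_iff] at ha
  rw [h₁.mem_dualCode_iff] at hb
  intro h
  have h0 := h _ (pauliOp_mem_stabilizedSpace ψ
    (fun d hd => (dotProduct_comm _ _).trans (ha d hd)) hb hf) f hf
  rw [pauliError, inner_pauliOp_pauliOp, inner_self_eq_zero] at h0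
  exact hf0 h0

/-! ### Minimum distance and purity -/

variable [DecidableEq F]

/-- In both cases of the definition of the minimum distance, only non-identity errors that do not
map the code to an orthogonal subspace are counted. -/
lemma le_minDist {ψ : AddChar F ℂ} {Q : Submodule ℂ (QuditSpace F (Fin n ⊕ Fin c))} {d : ℕ∞}
    (h : ∀ a b : Fin n → F, (a ≠ 0 ∨ b ≠ 0) → ¬ MapsToOrthogonal Q (pauliError ψ c a b) →
      d ≤ pauliWeight a b) : d ≤ minDist ψ Q := by
  unfold minDist
  split_ifs
  · refine le_sInf ?_
    rintro _ ⟨a, b, hab, hE, rfl⟩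
    exact h a b hab hE
  · refine le_sInf ?_
    rintro _ ⟨a, b, hE, rfl⟩
    refine h a b ?_ fun h0 => hE ⟨0, fun u hu v hv => by rw [h0 u hu v hv, zero_mul]⟩
    by_contra! ⟨ha, hb⟩
    -- The identity is detected, with scalar `1`.
    refine hE ⟨1, fun u _ v _ => ?_⟩
    rw [ha, hb, pauliError, Sum.elim_zero_zero, pauliOp_zero, one_mul]

lemma IsPureCode.minDist_le_pauliWeight {ψ : AddChar F ℂ} {C₁ C₂ : Submodule F (Fin n → F)}
    {Q : Submodule ℂ (QuditSpace F (Fin n ⊕ Fin c))} (hpure : IsPureCode ψ Q)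
    (hQ : IsCSSCode ψ C₁ C₂ Q) {a b : Fin n → F} (hab : a ≠ 0 ∨ b ≠ 0)
    (ha : a ∈ dualCode C₂) (hb : b ∈ dualCode C₁) : minDist ψ Q ≤ pauliWeight a b :=
  not_lt.mp fun h => not_mapsToOrthogonal_of_mem_dualCode hQ ha hb (hpure a b hab h)

end CSS

theorem mainTheorem11 {F : Type*} [Field F] [Fintype F] [DecidableEq F]
    (ψ : AddChar F ℂ) (hψ : ψ ≠ 1) {n c c' : ℕ}
    (C₁ C₂ C₂' : Submodule F (Fin n → F)) (hequiv : MonomiallyEquivalent C₂ C₂')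
    (Q : Submodule ℂ (QuditSpace F (Fin n ⊕ Fin c))) (hQ : IsCSSCode ψ C₁ C₂ Q)
    (hpure : IsPureCode ψ Q)
    (Q' : Submodule ℂ (QuditSpace F (Fin n ⊕ Fin c'))) (hQ' : IsCSSCode ψ C₁ C₂' Q') :
    minDist ψ Q ≤ minDist ψ Q' := by
  obtain ⟨M, hM, rfl⟩ := hequiv
  refine le_minDist fun a b hab hE => ?_
  obtain ⟨ha, hb⟩ := mem_dualCode_of_not_mapsToOrthogonal hψ hQ' hE
  rcases hab with ha0 | hb0
  · have hMa : M *ᵥ a ≠ 0 := fun h =>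
      ha0 (Matrix.mulVec_injective_iff_isUnit.mpr hM.1 (h.trans (Matrix.mulVec_zero M).symm))
    refine (hpure.minDist_le_pauliWeight hQ (Or.inl hMa) (mulVec_mem_dualCode ha)
      (dualCode C₁).zero_mem).trans (Nat.cast_le.mpr ?_)
    rw [pauliWeight_zero_right]
    exact (hM.hammingNorm_mulVec_le a).trans (hammingNorm_le_pauliWeight_left a b)
  · refine (hpure.minDist_le_pauliWeight hQ (Or.inr hb0) (dualCode C₂).zero_mem hb).trans
      (Nat.cast_le.mpr ?_)
    rw [pauliWeight_zero_left]
    exact hammingNorm_le_pauliWeight_right a b
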